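/- For $x>0$ let $\varphi(x)\in[-\frac{\pi}{2},\frac{\pi}{2}]$ be the unique solution of \[ \frac{\sin\varphi}{\cos\varphi-\left(\frac{\pi}{2}-\varphi\right)\sin\varphi}=\frac{x}{\pi}, \] and put $\iota(x)=\frac{x}{\sin\varphi(x)}$ and $f(x)=\frac{\iota(x)}{x}$, so that $f(x)>1$. Let $g(t)=\frac{\arccos(1/t)}{\sqrt{1-1/t^2}}$ for $t>1$, let $K_0(z)=\int_0^\infty e^{-z\cosh t}\,dt$ $(z>0)$ be the modified Bessel function of the second kind of order $0$, and for $x,y>0$, $s\in\mathbb{R}$ let \[ F(y,x,s)=2y\int_0^\infty K_0\bigl(2yt\,\psi(st)\bigr)\,e^{-2xt}\,dt,\qquad \psi(z)=\frac{\sinh z}{z}\ (z\neq 0),\quad \psi(0)=1 . \] Define, for $x>0$, \[ \Theta_0(x)=-\frac{\pi}{8x^2}\,g''(f(x))\,\frac{f(x)}{\sqrt{f(x)^2-1}}-\frac{\partial^2F}{\partial s^2}(\iota(x),x,0)\,\frac{2}{\pi}\,\frac{\sqrt{f(x)^2-1}}{f(x)} , \] \[ \zeta_x=\frac{\pi}{4}\,\frac{f(x)}{\sqrt{f(x)^2-1}}\left(\frac{1}{2\pi^2}-\int_0^x\Theta_0(t)\,dt\right).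 \] Then $\Theta_0$ is integrable on $(0,x)$ for every $x>0$, the map $x\mapsto\zeta_x$ is continuous on $(0,\infty)$, and \[ \lim_{x\to0}\zeta_x=\frac{1}{8\pi},\qquad \lim_{x\to\infty}\zeta_x=-\infty . \] Moreover, there exists a unique $x_0\in(0,\infty)$ such that, for $x>0$, $\zeta_x=0$ if and only if $x=x_0$. -/

import Mathlib

open Set Filter Topology MeasureTheory

namespace BesselZeta

noncomputable section

/-- The modified Bessel function of the second kind `K_ν(x)`, for `x > 0`. -/
def besselK (ν x : ℝ) : ℝ :=
  ∫ t in Ioi (0 : ℝ), Real.exp (-x * Real.cosh t) * Real.cosh (ν * t)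

/-- The map `φ ↦ π sin φ / (cos φ - (π/2 - φ) sin φ)`. -/
def angleMap (φ : ℝ) : ℝ :=
  Real.pi * (Real.sin φ / (Real.cos φ - (Real.pi / 2 - φ) * Real.sin φ))

/-- The solution `φ = φ(x) ∈ [-π/2, π/2]` of
`sin φ / (cos φ - (π/2 - φ) sin φ) = x / π`; for `x > 0` it exists and is unique. -/
def angle (x : ℝ) : ℝ :=
  Function.invFunOn angleMap (Icc (-(Real.pi / 2)) (Real.pi / 2)) x

/-- The function `ι`, the limit of `j_{xk,k} / k` as `k → ∞`: `ι(0) = π` and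
`ι(x) = x / sin φ(x)` for `x ≠ 0`. -/
def iota (x : ℝ) : ℝ :=
  if x = 0 then Real.pi else x / Real.sin (angle x)

/-- `f(x) = ι(x) / x`, for `x > 0`. -/
def f (x : ℝ) : ℝ := iota x / x

/-- `g(t) = arccos (1/t) / √(1 - 1/t²)`, for `t > 1`. -/
def g (t : ℝ) : ℝ := Real.arccos (1 / t) / Real.sqrt (1 - 1 / t ^ 2)

/-- The analytic function `sinh x / x`, with value `1` at `x = 0`. -/
def psi (x : ℝ) : ℝ := if x = 0 then 1 else Real.sinh x / x

/-- `F(y, x, s) = 2 y ∫₀^∞ K₀(2 y t · sinh(s t) / (s t)) exp(-2 x t) dt`, for `x, y > 0`. -/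
def F (y x s : ℝ) : ℝ :=
  2 * y * ∫ t in Ioi (0 : ℝ), besselK 0 (t * (2 * y) * psi (s * t)) * Real.exp (-2 * x * t)

/-- `Θ₀(x) = -π/(8x²) g''(f(x)) f(x)/√(f(x)²-1) - ∂²F/∂s²(ι(x), x, 0) (2/π) √(f(x)²-1)/f(x)`. -/
def Theta0 (x : ℝ) : ℝ :=
  -(Real.pi / (8 * x ^ 2)) * iteratedDeriv 2 g (f x) * (f x / Real.sqrt (f x ^ 2 - 1))
    - iteratedDeriv 2 (fun s => F (iota x) x s) 0 * (2 / Real.pi)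
      * (Real.sqrt (f x ^ 2 - 1) / f x)

/-- `ζ_x = (π/4) f(x)/√(f(x)²-1) (1/(2π²) - ∫₀^x Θ₀(t) dt)`, for `x > 0`. -/
def zeta (x : ℝ) : ℝ :=
  Real.pi / 4 * (f x / Real.sqrt (f x ^ 2 - 1))
    * (1 / (2 * Real.pi ^ 2) - ∫ t in (0 : ℝ)..x, Theta0 t)

end

end BesselZeta

/-!
Everything becomes explicit in the angle `θ = π/2 - φ(x) ∈ (0, π/2)` (`coangle`), which is the
solution of `tan θ - θ = π / x`. Write `c = cos θ`, `s = sin θ`. Then `f(x) = 1 / c`,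
`ι(x) = π / (s - θ c)`, `f / √(f² - 1) = 1 / s`, and `g(1 / c) = θ / s`, so `g''(f(x))` is
elementary (`iteratedDeriv_two_g`).

For the Bessel term, differentiate twice under the integral sign
(`hasDerivAt_integral_integrand`, `hasDerivAt_integral_integrandDeriv`). Since `psi'(0) = 0` and
`psi''(0) = 1/3`, only a Laplace transform of `t³ K₁(2 y t)` survives at `s = 0`; exchanging the
order of integration turns it into `∂²F/∂s²(y, y c, 0) = -J / (2 y²)`, where
`J = ∫₀^∞ cosh v (cosh v + c)⁻⁴ dv` (`iteratedDeriv_two_F`), and `J` has an elementary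
antiderivative (`coshIntegral_eq`).

Hence `Θ₀` is a sum of two terms, the first positive by `two_mul_sin_add_sub_pos` and the second
nonnegative since `J ≥ 0` (`Theta0_pos`). In the variable `θ` the form `Θ₀ dx` has an elementary
primitive (`primitive`, `hasDerivAt_primitive_coangle`), which vanishes at `θ = π/2`, that is, as
`x → 0`. A nonnegative derivative of a function continuous up to the endpoint is integrable, so
`∫₀ˣ Θ₀ = primitive θ(x)` (`integral_Theta0`) and
`ζ_x = π / (4 s) (1 / (2 π²) - primitive θ(x))` (`zeta_eq`).

The limit at `0` follows from `s → 1`. As `x → ∞` we have `θ → 0`, and `primitive θ` tends to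
`1 / (2 π²) + (1/8 - 5 / (6 π²)) / 3`, which is larger than `1 / (2 π²)` because `π² > 20/3`, while
`1 / s → ∞`; so `ζ_x → -∞`. The bracket is strictly decreasing in `x` and changes sign, which gives
exactly one zero.
-/

namespace BesselZeta

open Real

/-! ### The primitive of `Θ₀` in the angular variable -/

/-- The integral `∫₀ˣ Θ₀`, expressed through the angle `θ = π/2 - φ(x) ∈ (0, π/2)`. -/
noncomputable def primitive (θ : ℝ) : ℝ :=
  (1 / 8 - 5 / (6 * π ^ 2)) * (cos θ ^ 2 * ((sin θ - θ * cos θ) / sin θ ^ 3))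
    + θ * cos θ / sin θ / (2 * π ^ 2)

lemma hasDerivAt_sin_sub_mul_cos (θ : ℝ) :
    HasDerivAt (fun θ => sin θ - θ * cos θ) (θ * sin θ) θ := by
  refine ((hasDerivAt_sin θ).sub ((hasDerivAt_id θ).mul (hasDerivAt_cos θ))).congr_deriv ?_
  simp only [id]; ring

lemma sin_sub_mul_cos_pos {θ : ℝ} (h0 : 0 < θ) (h1 : θ < π / 2) : 0 < sin θ - θ * cos θ := by
  have hc : 0 < cos θ := cos_pos_of_mem_Ioo ⟨by linarith, h1⟩
  have ht := lt_tan h0 h1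
  rw [tan_eq_sin_div_cos, lt_div_iff₀ hc] at ht
  linarith

/-- The numerator of `-g''(1 / cos θ)` is positive: it vanishes at `0` and its derivative is
`3 sin θ (θ - sin θ cos θ)`. -/
lemma two_mul_sin_add_sub_pos {θ : ℝ} (h0 : 0 < θ) (h1 : θ < π / 2) :
    0 < 2 * sin θ + sin θ * cos θ ^ 2 - 3 * θ * cos θ := by
  have hd : ∀ t : ℝ, HasDerivAt (fun θ => 2 * sin θ + sin θ * cos θ ^ 2 - 3 * θ * cos θ)
      (3 * sin t * (t - sin t * cos t)) t := by
    intro t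
    refine ((((hasDerivAt_sin t).const_mul 2).add
      ((hasDerivAt_sin t).mul ((hasDerivAt_cos t).pow 2))).sub
      (((hasDerivAt_id t).const_mul 3).mul (hasDerivAt_cos t))).congr_deriv ?_
    simp only [id, Pi.pow_apply]
    push_cast
    linear_combination (cos t) * sin_sq_add_cos_sq t
  have hm : StrictMonoOn (fun θ => 2 * sin θ + sin θ * cos θ ^ 2 - 3 * θ * cos θ)
      (Icc 0 (π / 2)) := by
    apply strictMonoOn_of_deriv_pos (convex_Icc _ _)
    · exact fun t _ => (hd t).continuousAt.continuousWithinAt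
    · intro t ht
      rw [interior_Icc] at ht
      rw [(hd t).deriv]
      have hs : 0 < sin t := sin_pos_of_pos_of_lt_pi ht.1 (by linarith [ht.2, pi_pos])
      have hst := sin_lt ht.1
      have : sin t * cos t ≤ sin t := mul_le_of_le_one_right hs.le (cos_le_one t)
      have : 0 < t - sin t * cos t := by linarith
      positivity
  have := hm (left_mem_Icc.2 (by positivity)) ⟨h0.le, h1.le⟩ h0
  simpa using this

lemma hasDerivAt_primitive {θ : ℝ} (hs : sin θ ≠ 0) :
    HasDerivAt primitive (-(cos θ * (2 * sin θ + sin θ * cos θ ^ 2 - 3 * θ * cos θ)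
      / (8 * sin θ ^ 4) + (3 * θ * (1 + 4 * cos θ ^ 2) - cos θ * sin θ * (13 + 2 * cos θ ^ 2))
      / (6 * π ^ 2 * sin θ ^ 4))) θ := by
  have h1 := ((hasDerivAt_cos θ).pow 2).mul
    ((hasDerivAt_sin_sub_mul_cos θ).div ((hasDerivAt_sin θ).pow 3) (pow_ne_zero 3 hs))
  have h2 := ((hasDerivAt_id θ).mul (hasDerivAt_cos θ)).div (hasDerivAt_sin θ) hs
  refine ((h1.const_mul (1 / 8 - 5 / (6 * π ^ 2))).add
    (h2.div_const (2 * π ^ 2))).congr_deriv ?_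
  have h := sin_sq_add_cos_sq θ
  have hp := pi_ne_zero
  simp only [id, Pi.pow_apply, Pi.mul_apply, Pi.div_apply]
  clear h1 h2
  generalize sin θ = s at *
  generalize cos θ = c at *
  field_simp
  grind

lemma tendsto_div_sin : Tendsto (fun θ : ℝ => θ / sin θ) (𝓝[>] 0) (𝓝 1) := by
  have h : Tendsto (fun θ => (sinc θ)⁻¹) (𝓝[>] 0) (𝓝 1) := by
    have := (continuous_sinc.tendsto 0).inv₀ (by simp)
    simpa using this.mono_left nhdsWithin_le_nhds
  refine h.congr' ?_
  filter_upwards [self_mem_nhdsWithin] with θ hθ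
  rw [sinc_of_ne_zero (ne_of_gt hθ), inv_div]

lemma tendsto_sin_sub_mul_cos_div :
    Tendsto (fun θ => (sin θ - θ * cos θ) / sin θ ^ 3) (𝓝[>] 0) (𝓝 (1 / 3)) := by
  have hmem : Ioo 0 (π / 2) ∈ 𝓝[>] (0 : ℝ) := Ioo_mem_nhdsGT (by positivity)
  have hcos : Tendsto cos (𝓝[>] 0) (𝓝 1) := by
    simpa using (continuous_cos.tendsto 0).mono_left nhdsWithin_le_nhds
  refine HasDerivAt.lhopital_zero_nhdsGT (f' := fun θ => θ * sin θ)
    (g' := fun θ => 3 * sin θ ^ 2 * cos θ) ?_ ?_ ?_ ?_ ?_ ?_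
  · exact Eventually.of_forall hasDerivAt_sin_sub_mul_cos
  · exact Eventually.of_forall fun θ => ((hasDerivAt_sin θ).pow 3).congr_deriv (by simp)
  · filter_upwards [hmem] with θ hθ
    have hs : 0 < sin θ := sin_pos_of_pos_of_lt_pi hθ.1 (by linarith [hθ.2, pi_pos])
    have hc : 0 < cos θ := cos_pos_of_mem_Ioo ⟨by linarith [hθ.1, pi_pos], hθ.2⟩
    positivity
  · have : Continuous fun θ => sin θ - θ * cos θ := by fun_prop
    simpa using (this.tendsto 0).mono_left nhdsWithin_le_nhds
  · have : Continuous fun θ => sin θ ^ 3 := by fun_prop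
    simpa using (this.tendsto 0).mono_left nhdsWithin_le_nhds
  · have := tendsto_div_sin.div (hcos.const_mul 3) (by norm_num)
    simp only [mul_one] at this
    refine this.congr' ?_
    filter_upwards [hmem] with θ hθ
    have hs : 0 < sin θ := sin_pos_of_pos_of_lt_pi hθ.1 (by linarith [hθ.2, pi_pos])
    have hc : 0 < cos θ := cos_pos_of_mem_Ioo ⟨by linarith [hθ.1, pi_pos], hθ.2⟩
    simp only [Pi.div_apply]
    field_simp

lemma tendsto_primitive_zero :
    Tendsto primitive (𝓝[>] 0) (𝓝 ((1 / 8 - 5 / (6 * π ^ 2)) / 3 + 1 / (2 * π ^ 2))) := by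
  have hcos : Tendsto cos (𝓝[>] 0) (𝓝 1) := by
    simpa using (continuous_cos.tendsto 0).mono_left nhdsWithin_le_nhds
  have h := (((hcos.pow 2).mul tendsto_sin_sub_mul_cos_div).const_mul
    (1 / 8 - 5 / (6 * π ^ 2))).add ((tendsto_div_sin.mul hcos).div_const (2 * π ^ 2))
  have e : (1 / 8 - 5 / (6 * π ^ 2)) * (1 ^ 2 * (1 / 3)) + 1 * 1 / (2 * π ^ 2)
      = (1 / 8 - 5 / (6 * π ^ 2)) / 3 + 1 / (2 * π ^ 2) := by ring
  rw [e] at h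
  refine h.congr fun θ => ?_
  simp only [primitive]; ring

/-- The inequality behind the change of sign of `ζ`; it amounts to `π² > 20 / 3`. -/
lemma exists_primitive_gt :
    ∃ θ ∈ Ioo 0 (π / 2), 1 / (2 * π ^ 2) < primitive θ := by
  have hlim : 1 / (2 * π ^ 2) < (1 / 8 - 5 / (6 * π ^ 2)) / 3 + 1 / (2 * π ^ 2) := by
    have hp : 5 / (6 * π ^ 2) < 1 / 8 := by
      rw [div_lt_div_iff₀ (by positivity) (by norm_num)]
      nlinarith [pi_gt_three]
    linarith
  have h1 := tendsto_primitive_zero.eventually (lt_mem_nhds hlim)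
  have h2 : Ioo 0 (π / 2) ∈ 𝓝[>] (0 : ℝ) := Ioo_mem_nhdsGT (by positivity)
  obtain ⟨θ, h, h'⟩ := (h1.and h2).exists
  exact ⟨θ, h', h⟩

/-! ### The angle as a smooth function of `x` -/

/-- The complementary angle `θ = π/2 - φ(x)`, characterised by `tan θ - θ = π / x`. -/
noncomputable def coangle (x : ℝ) : ℝ := π / 2 - angle x

/-- The inverse function `θ ↦ π / (tan θ - θ)` of `coangle`. -/
noncomputable def ofCoangle (θ : ℝ) : ℝ := π * (cos θ / (sin θ - θ * cos θ))

lemma angleMap_pi_div_two_sub (θ : ℝ) : angleMap (π / 2 - θ) = ofCoangle θ := by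
  simp only [angleMap, ofCoangle, sin_pi_div_two_sub, cos_pi_div_two_sub, sub_sub_cancel]

lemma ofCoangle_pos {θ : ℝ} (hθ : θ ∈ Ioo 0 (π / 2)) : 0 < ofCoangle θ := by
  have h1 := sin_sub_mul_cos_pos hθ.1 hθ.2
  have hc : 0 < cos θ := cos_pos_of_mem_Ioo ⟨by linarith [hθ.1, pi_pos], hθ.2⟩
  unfold ofCoangle
  positivity

lemma hasDerivAt_ofCoangle {θ : ℝ} (hθ : θ ∈ Ioo 0 (π / 2)) :
    HasDerivAt ofCoangle (-(π * sin θ ^ 2 / (sin θ - θ * cos θ) ^ 2)) θ := by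
  have h1 := sin_sub_mul_cos_pos hθ.1 hθ.2
  refine (((hasDerivAt_cos θ).div (hasDerivAt_sin_sub_mul_cos θ) h1.ne').const_mul
    π).congr_deriv ?_
  field_simp
  ring

lemma strictAntiOn_ofCoangle : StrictAntiOn ofCoangle (Ioo 0 (π / 2)) := by
  apply strictAntiOn_of_deriv_neg (convex_Ioo _ _)
  · exact fun t ht => (hasDerivAt_ofCoangle ht).continuousAt.continuousWithinAt
  · intro t ht
    rw [interior_Ioo] at ht
    rw [(hasDerivAt_ofCoangle ht).deriv]
    have h1 := sin_sub_mul_cos_pos ht.1 ht.2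
    have hs : 0 < sin t := sin_pos_of_pos_of_lt_pi ht.1 (by linarith [ht.2, pi_pos])
    have : 0 < π * sin t ^ 2 / (sin t - t * cos t) ^ 2 := by positivity
    linarith

lemma exists_ofCoangle_eq {x : ℝ} (hx : 0 < x) : ∃ θ ∈ Ioo 0 (π / 2), ofCoangle θ = x := by
  have hcont : ContinuousOn (fun θ => x * (sin θ - θ * cos θ) - π * cos θ) (Icc 0 (π / 2)) := by
    fun_prop
  have h := intermediate_value_Ioo (by positivity) hcont
  have h0 : (0 : ℝ) ∈ Ioo ((fun θ => x * (sin θ - θ * cos θ) - π * cos θ) 0)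
      ((fun θ => x * (sin θ - θ * cos θ) - π * cos θ) (π / 2)) := by
    simp [pi_pos, hx]
  obtain ⟨θ, hθ, e⟩ := h h0
  refine ⟨θ, hθ, ?_⟩
  have h1 := sin_sub_mul_cos_pos hθ.1 hθ.2
  simp only at e
  unfold ofCoangle
  rw [← mul_div_assoc, div_eq_iff h1.ne']
  linarith

/-- Outside `(0, π/2)` the map `ofCoangle` takes no positive value on `[0, π]`; at `0` this rests
on the convention for division by zero. -/
lemma coangle_spec {x : ℝ} (hx : 0 < x) :
    coangle x ∈ Ioo 0 (π / 2) ∧ ofCoangle (coangle x) = x := by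
  obtain ⟨θ, hθ, e⟩ := exists_ofCoangle_eq hx
  have hex : ∃ a ∈ Icc (-(π / 2)) (π / 2), angleMap a = x :=
    ⟨π / 2 - θ, ⟨by linarith [hθ.2, pi_pos], by linarith [hθ.1]⟩, by
      rw [angleMap_pi_div_two_sub, e]⟩
  have hmem : angle x ∈ Icc (-(π / 2)) (π / 2) := Function.invFunOn_mem hex
  have heq : angleMap (angle x) = x := Function.invFunOn_eq hex
  have h2 : ofCoangle (coangle x) = x := by
    rw [← angleMap_pi_div_two_sub, coangle, sub_sub_cancel, heq]
  refine ⟨⟨?_, ?_⟩, h2⟩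
  · rcases (show 0 ≤ coangle x by unfold coangle; linarith [hmem.2]).eq_or_lt with h | h
    · rw [← h] at h2
      simp [ofCoangle] at h2
      linarith
    · exact h
  · by_contra! h
    have hle : coangle x ≤ π := by unfold coangle; linarith [hmem.1]
    have hs : 0 ≤ sin (coangle x) := sin_nonneg_of_nonneg_of_le_pi (by linarith [pi_pos]) hle
    have hc : cos (coangle x) ≤ 0 := cos_nonpos_of_pi_div_two_le_of_le h (by linarith [pi_pos])
    have hd : 0 ≤ sin (coangle x) - coangle x * cos (coangle x) := by
      nlinarith [pi_pos]
    have : ofCoangle (coangle x) ≤ 0 :=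
      mul_nonpos_of_nonneg_of_nonpos pi_pos.le (div_nonpos_of_nonpos_of_nonneg hc hd)
    linarith

lemma coangle_ofCoangle {θ : ℝ} (hθ : θ ∈ Ioo 0 (π / 2)) : coangle (ofCoangle θ) = θ :=
  have h := coangle_spec (ofCoangle_pos hθ)
  strictAntiOn_ofCoangle.injOn h.1 hθ h.2

lemma strictAntiOn_coangle : StrictAntiOn coangle (Ioi 0) := by
  intro x hx y hy hxy
  have h1 := coangle_spec hx
  have h2 := coangle_spec hy
  rw [← h1.2, ← h2.2] at hxy
  exact (strictAntiOn_ofCoangle.lt_iff_gt h1.1 h2.1).1 hxy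

lemma continuousAt_coangle {x : ℝ} (hx : 0 < x) : ContinuousAt coangle x := by
  have hm : StrictMonoOn (fun x => -coangle x) (Ioi 0) := strictAntiOn_coangle.neg
  have him : (fun x => -coangle x) '' Ioi 0 ∈ 𝓝 (-coangle x) := by
    have hsp := (coangle_spec hx).1
    refine mem_of_superset (Ioo_mem_nhds (a := -(π / 2)) (b := 0) (by linarith [hsp.2])
      (by linarith [hsp.1])) ?_
    intro y hy
    have hy' : -y ∈ Ioo 0 (π / 2) := ⟨by linarith [hy.2], by linarith [hy.1]⟩
    exact ⟨ofCoangle (-y), ofCoangle_pos hy', by simp [coangle_ofCoangle hy']⟩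
  have := (hm.continuousAt_of_image_mem_nhds (Ioi_mem_nhds hx) him).neg
  rwa [show (-fun x => -coangle x) = coangle by ext; simp] at this

lemma hasDerivAt_coangle {x : ℝ} (hx : 0 < x) :
    HasDerivAt coangle (-(π * sin (coangle x) ^ 2
      / (sin (coangle x) - coangle x * cos (coangle x)) ^ 2))⁻¹ x := by
  have hθ := (coangle_spec hx).1
  refine (hasDerivAt_ofCoangle hθ).of_local_left_inverse (continuousAt_coangle hx) ?_ ?_
  · have h1 := sin_sub_mul_cos_pos hθ.1 hθ.2
    have hs : 0 < sin (coangle x) :=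
      sin_pos_of_pos_of_lt_pi hθ.1 (by linarith [hθ.2, pi_pos])
    exact neg_ne_zero.2 (by positivity)
  · filter_upwards [Ioi_mem_nhds hx] with y hy using (coangle_spec hy).2

lemma tendsto_coangle_zero : Tendsto coangle (𝓝[>] 0) (𝓝 (π / 2)) := by
  refine tendsto_order.2 ⟨fun a ha => ?_, fun a ha => ?_⟩
  · have hb : max a (π / 4) ∈ Ioo 0 (π / 2) :=
      ⟨lt_max_of_lt_right (by positivity), max_lt ha (by linarith [pi_pos])⟩
    filter_upwards [Ioo_mem_nhdsGT (ofCoangle_pos hb)] with x hx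
    have := strictAntiOn_coangle hx.1 (ofCoangle_pos hb) hx.2
    rw [coangle_ofCoangle hb] at this
    exact (le_max_left _ _).trans_lt this
  · filter_upwards [self_mem_nhdsWithin] with x hx
    exact (coangle_spec hx).1.2.trans ha

lemma iota_eq {x : ℝ} (hx : 0 < x) : iota x = x / cos (coangle x) := by
  rw [iota, if_neg hx.ne', coangle, cos_pi_div_two_sub]

lemma f_eq {x : ℝ} (hx : 0 < x) : f x = 1 / cos (coangle x) := by
  rw [f, iota_eq hx]
  field_simp

lemma sqrt_inv_sq_sub_one {θ : ℝ} (hθ : θ ∈ Ioo 0 (π / 2)) :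
    √((1 / cos θ) ^ 2 - 1) = sin θ / cos θ := by
  have hs : 0 < sin θ := sin_pos_of_pos_of_lt_pi hθ.1 (by linarith [hθ.2, pi_pos])
  have hc : 0 < cos θ := cos_pos_of_mem_Ioo ⟨by linarith [hθ.1, pi_pos], hθ.2⟩
  rw [sqrt_eq_iff_mul_self_eq_of_pos (by positivity)]
  field_simp
  linarith [sin_sq_add_cos_sq θ]

/-! ### The second derivative of `g` -/

lemma hasDerivAt_arccos_inv {t : ℝ} (ht : 1 < t) :
    HasDerivAt (fun t : ℝ => arccos (1 / t)) (1 / (t * √(t ^ 2 - 1))) t := by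
  have h0 : t ≠ 0 := by linarith
  have h1 : 1 / t < 1 := by rw [div_lt_one (by linarith)]; exact ht
  have h2 : -1 < 1 / t := by have : 0 < 1 / t := by positivity
                             linarith
  have hi : HasDerivAt (fun t : ℝ => 1 / t) (-1 / t ^ 2) t := by
    simpa [neg_div] using hasDerivAt_inv h0
  refine ((hasDerivAt_arccos h2.ne' h1.ne).comp t hi).congr_deriv ?_
  have hr : √(1 - (1 / t) ^ 2) = √(t ^ 2 - 1) / t := by
    rw [show 1 - (1 / t) ^ 2 = (t ^ 2 - 1) / t ^ 2 by field_simp,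
      sqrt_div (by nlinarith), sqrt_sq (by linarith)]
  have : 0 < √(t ^ 2 - 1) := sqrt_pos.2 (by nlinarith)
  rw [hr]
  field_simp

lemma hasDerivAt_sqrt_sq_sub_one {t : ℝ} (ht : 1 < t) :
    HasDerivAt (fun t : ℝ => √(t ^ 2 - 1)) (t / √(t ^ 2 - 1)) t := by
  refine ((((hasDerivAt_id t).pow 2).sub_const 1).sqrt
    (by simp only [id, Pi.pow_apply]; nlinarith)).congr_deriv ?_
  simp only [id, Pi.pow_apply]
  field_simp
  norm_num

lemma hasDerivAt_g {t : ℝ} (ht : 1 < t) :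
    HasDerivAt g (1 / √(t ^ 2 - 1) ^ 2 - arccos (1 / t) / √(t ^ 2 - 1) ^ 3) t := by
  have hr : 0 < √(t ^ 2 - 1) := sqrt_pos.2 (by nlinarith)
  have hsq : √(t ^ 2 - 1) ^ 2 = t ^ 2 - 1 := sq_sqrt (by nlinarith)
  have h : HasDerivAt (fun t : ℝ => arccos (1 / t) * t / √(t ^ 2 - 1))
      (1 / √(t ^ 2 - 1) ^ 2 - arccos (1 / t) / √(t ^ 2 - 1) ^ 3) t := by
    refine (((hasDerivAt_arccos_inv ht).mul (hasDerivAt_id t)).div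
      (hasDerivAt_sqrt_sq_sub_one ht) hr.ne').congr_deriv ?_
    simp only [id, Pi.mul_apply]
    generalize √(t ^ 2 - 1) = r at *
    field_simp
    grind
  refine h.congr_of_eventuallyEq ?_
  filter_upwards [lt_mem_nhds ht] with u hu
  have : √(1 - 1 / u ^ 2) = √(u ^ 2 - 1) / u := by
    rw [show 1 - 1 / u ^ 2 = (u ^ 2 - 1) / u ^ 2 by field_simp,
      sqrt_div (by nlinarith), sqrt_sq (by linarith)]
  rw [g, this, div_div_eq_mul_div]

lemma iteratedDeriv_two_g {θ : ℝ} (hθ : θ ∈ Ioo 0 (π / 2)) :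
    iteratedDeriv 2 g (1 / cos θ) = -(cos θ ^ 3
      * (2 * sin θ + sin θ * cos θ ^ 2 - 3 * θ * cos θ) / sin θ ^ 5) := by
  have hs : 0 < sin θ := sin_pos_of_pos_of_lt_pi hθ.1 (by linarith [hθ.2, pi_pos])
  have hc : 0 < cos θ := cos_pos_of_mem_Ioo ⟨by linarith [hθ.1, pi_pos], hθ.2⟩
  have ht : 1 < 1 / cos θ := by
    rw [lt_div_iff₀ hc, one_mul, ← cos_zero]
    exact cos_lt_cos_of_nonneg_of_le_pi_div_two le_rfl hθ.2.le hθ.1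
  have hr : √((1 / cos θ) ^ 2 - 1) ≠ 0 := by rw [sqrt_inv_sq_sub_one hθ]; positivity
  have hev : deriv g =ᶠ[𝓝 (1 / cos θ)]
      fun t => 1 / √(t ^ 2 - 1) ^ 2 - arccos (1 / t) / √(t ^ 2 - 1) ^ 3 := by
    filter_upwards [lt_mem_nhds ht] with u hu using (hasDerivAt_g hu).deriv
  rw [iteratedDeriv_succ, iteratedDeriv_one, hev.deriv_eq]
  have h1 := ((hasDerivAt_const (1 / cos θ) (1 : ℝ)).div
    ((hasDerivAt_sqrt_sq_sub_one ht).pow 2) (pow_ne_zero 2 hr)).sub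
    ((hasDerivAt_arccos_inv ht).div ((hasDerivAt_sqrt_sq_sub_one ht).pow 3) (pow_ne_zero 3 hr))
  refine h1.deriv.trans ?_
  simp only [Pi.pow_apply]
  rw [sqrt_inv_sq_sub_one hθ, one_div_one_div,
    arccos_cos hθ.1.le (by linarith [hθ.2, pi_pos])]
  have h := sin_sq_add_cos_sq θ
  field_simp
  grind

/-! ### The integral `∫₀^∞ cosh v (cosh v + cos θ)⁻⁴ dv` -/

lemma tendsto_sinh_div_cosh_add (c : ℝ) :
    Tendsto (fun v => sinh v / (cosh v + c)) atTop (𝓝 1) := by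
  have h1 : Tendsto (fun v : ℝ => exp (-v)) atTop (𝓝 0) := tendsto_exp_neg_atTop_nhds_zero
  have h : Tendsto (fun v : ℝ => (1 - exp (-v) ^ 2) / (1 + exp (-v) ^ 2 + 2 * c * exp (-v)))
      atTop (𝓝 ((1 - 0 ^ 2) / (1 + 0 ^ 2 + 2 * c * 0))) :=
    ((h1.pow 2).const_sub 1).div (((h1.pow 2).const_add 1).add (h1.const_mul _)) (by norm_num)
  have e : (1 - 0 ^ 2) / (1 + 0 ^ 2 + 2 * c * 0) = (1 : ℝ) := by norm_num
  rw [e] at h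
  refine h.congr fun v => ?_
  rw [sinh_eq, cosh_eq, exp_neg]
  have := exp_pos v
  rw [← mul_div_mul_left ((exp v - (exp v)⁻¹) / 2) _ (show 2 * (exp v)⁻¹ ≠ 0 by positivity)]
  congr 1 <;> field_simp

lemma tendsto_cosh_atTop : Tendsto cosh atTop atTop := by
  refine tendsto_atTop_mono (fun v => ?_) (tendsto_exp_atTop.const_mul_atTop (r := 1 / 2)
    (by norm_num))
  rw [cosh_eq]
  linarith [exp_pos (-v)]

lemma tendsto_sinh_div_cosh_add_pow (c : ℝ) (n : ℕ) :
    Tendsto (fun v => sinh v / (cosh v + c) ^ (n + 2)) atTop (𝓝 0) := by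
  have h1 : Tendsto (fun v => ((cosh v + c) ^ (n + 1))⁻¹) atTop (𝓝 0) :=
    ((tendsto_pow_atTop n.succ_ne_zero).comp
      (tendsto_atTop_add_const_right _ c tendsto_cosh_atTop)).inv_tendsto_atTop
  have h := (tendsto_sinh_div_cosh_add c).mul h1
  rw [mul_zero] at h
  refine h.congr fun v => ?_
  rw [← div_eq_mul_inv, div_div, ← pow_succ']

lemma hasDerivAt_sinh_div_cosh_add_pow {c v : ℝ} (hv : cosh v + c ≠ 0) (n : ℕ) :
    HasDerivAt (fun v => sinh v / (cosh v + c) ^ (n + 1))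
      ((cosh v * (cosh v + c) - (n + 1) * sinh v ^ 2) / (cosh v + c) ^ (n + 2)) v := by
  refine ((hasDerivAt_sinh v).div (((hasDerivAt_cosh v).add_const c).pow (n + 1))
    (pow_ne_zero _ hv)).congr_deriv ?_
  simp only [Pi.pow_apply, add_tsub_cancel_right]
  push_cast
  field_simp
  ring

lemma hasDerivAt_arctan_sinh_div {θ : ℝ} (hθ : θ ∈ Ioo 0 (π / 2)) (v : ℝ) :
    HasDerivAt (fun v => arctan (sin θ / (1 + cos θ) * (sinh v / (cosh v + 1))))
      (sin θ / (2 * (cosh v + cos θ))) v := by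
  have hc : 0 < cos θ := cos_pos_of_mem_Ioo ⟨by linarith [hθ.1, pi_pos], hθ.2⟩
  have hC := cosh_pos v
  refine (((hasDerivAt_sinh v).div ((hasDerivAt_cosh v).add_const 1) (by positivity)).const_mul
    (sin θ / (1 + cos θ))).arctan.congr_deriv ?_
  have h1 := sin_sq_add_cos_sq θ
  have h2 := cosh_sq v
  have hpos : 0 < (1 + cos θ) ^ 2 * (cosh v + 1) ^ 2 + (sin θ * sinh v) ^ 2 := by positivity
  have e1 : 1 + (sin θ / (1 + cos θ) * (sinh v / (cosh v + 1))) ^ 2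
      = ((1 + cos θ) ^ 2 * (cosh v + 1) ^ 2 + (sin θ * sinh v) ^ 2)
        / ((1 + cos θ) ^ 2 * (cosh v + 1) ^ 2) := by
    field_simp
  have e2 : (1 + cos θ) ^ 2 * (cosh v + 1) ^ 2 + (sin θ * sinh v) ^ 2
      = 2 * (1 + cos θ) * (cosh v + 1) * (cosh v + cos θ) := by
    rw [mul_pow, show sin θ ^ 2 = 1 - cos θ ^ 2 by linarith,
      show sinh v ^ 2 = cosh v ^ 2 - 1 by linarith]
    ring
  have e3 : cosh v * (cosh v + 1) - sinh v * sinh v = cosh v + 1 := by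
    rw [← pow_two (sinh v), show sinh v ^ 2 = cosh v ^ 2 - 1 by linarith]
    ring
  simp only [Pi.div_apply]
  rw [e1, e2, e3]
  field_simp

/-- The integral `∫₀^∞ cosh v (cosh v + cos θ)⁻⁴ dv`, which carries `∂²F/∂s²`. -/
noncomputable def coshIntegral (θ : ℝ) : ℝ :=
  ∫ v in Ioi (0 : ℝ), cosh v / (cosh v + cos θ) ^ 4

lemma coshIntegral_nonneg {θ : ℝ} (hθ : θ ∈ Ioo 0 (π / 2)) : 0 ≤ coshIntegral θ := by
  have hc : 0 < cos θ := cos_pos_of_mem_Ioo ⟨by linarith [hθ.1, pi_pos], hθ.2⟩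
  exact integral_nonneg fun v => by have := cosh_pos v; positivity

/-- An explicit antiderivative of `cosh v (cosh v + cos θ)⁻⁴`, found by successively lowering the
power of the denominator with the derivatives of `sinh v (cosh v + cos θ)⁻ⁿ`, `n = 3, 2, 1`. -/
noncomputable def coshPrimitive (θ v : ℝ) : ℝ :=
  (1 + 4 * cos θ ^ 2) / sin θ ^ 7 * arctan (sin θ / (1 + cos θ) * (sinh v / (cosh v + 1)))
    - cos θ * (13 + 2 * cos θ ^ 2) / (6 * sin θ ^ 6) * (sinh v / (cosh v + cos θ) ^ (0 + 1))
    + (3 + 2 * cos θ ^ 2) / (6 * sin θ ^ 4) * (sinh v / (cosh v + cos θ) ^ (1 + 1))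
    - cos θ / (3 * sin θ ^ 2) * (sinh v / (cosh v + cos θ) ^ (2 + 1))

lemma hasDerivAt_coshPrimitive {θ : ℝ} (hθ : θ ∈ Ioo 0 (π / 2)) (v : ℝ) :
    HasDerivAt (coshPrimitive θ) (cosh v / (cosh v + cos θ) ^ 4) v := by
  have hs : 0 < sin θ := sin_pos_of_pos_of_lt_pi hθ.1 (by linarith [hθ.2, pi_pos])
  have hc : 0 < cos θ := cos_pos_of_mem_Ioo ⟨by linarith [hθ.1, pi_pos], hθ.2⟩
  have hD : 0 < cosh v + cos θ := by have := cosh_pos v; positivity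
  have h := ((((hasDerivAt_arctan_sinh_div hθ v).const_mul
    ((1 + 4 * cos θ ^ 2) / sin θ ^ 7)).sub
    ((hasDerivAt_sinh_div_cosh_add_pow hD.ne' 0).const_mul
      (cos θ * (13 + 2 * cos θ ^ 2) / (6 * sin θ ^ 6)))).add
    ((hasDerivAt_sinh_div_cosh_add_pow hD.ne' 1).const_mul
      ((3 + 2 * cos θ ^ 2) / (6 * sin θ ^ 4)))).sub
    ((hasDerivAt_sinh_div_cosh_add_pow hD.ne' 2).const_mul (cos θ / (3 * sin θ ^ 2)))
  refine h.congr_deriv ?_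
  push_cast
  rw [show sinh v ^ 2 = cosh v ^ 2 - 1 by linarith [cosh_sq v]]
  have h1 := sin_sq_add_cos_sq θ
  clear h
  generalize hd : cosh v + cos θ = D at *
  obtain hC : cosh v = D - cos θ := by linarith
  rw [hC]
  generalize sin θ = s at *
  generalize cos θ = c at *
  have h2 : c ^ 2 = 1 - s ^ 2 := by linarith
  have h3 : c ^ 3 = c * (1 - s ^ 2) := by rw [← h2]; ring
  have h4 : c ^ 4 = (1 - s ^ 2) ^ 2 := by rw [← h2]; ring
  have h5 : c ^ 5 = c * (1 - s ^ 2) ^ 2 := by rw [← h2]; ring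
  field_simp
  ring_nf
  simp only [h2, h3, h4, h5]
  ring

lemma coshIntegral_eq {θ : ℝ} (hθ : θ ∈ Ioo 0 (π / 2)) :
    coshIntegral θ = (3 * θ * (1 + 4 * cos θ ^ 2) - cos θ * sin θ * (13 + 2 * cos θ ^ 2))
      / (6 * sin θ ^ 7) := by
  have hs : 0 < sin θ := sin_pos_of_pos_of_lt_pi hθ.1 (by linarith [hθ.2, pi_pos])
  have hc : 0 < cos θ := cos_pos_of_mem_Ioo ⟨by linarith [hθ.1, pi_pos], hθ.2⟩
  have hhalf : sin θ / (1 + cos θ) = tan (θ / 2) := by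
    have hch : 0 < cos (θ / 2) :=
      cos_pos_of_mem_Ioo ⟨by linarith [hθ.1, pi_pos], by linarith [hθ.1, hθ.2]⟩
    have e1 : sin θ = 2 * sin (θ / 2) * cos (θ / 2) := by
      rw [← sin_two_mul]; congr 1; ring
    have e2 : cos θ = 2 * cos (θ / 2) ^ 2 - 1 := by
      rw [← cos_two_mul]; congr 1; ring
    rw [e1, e2, tan_eq_sin_div_cos]
    field_simp
    ring
  have hlim : Tendsto (coshPrimitive θ) atTop
      (𝓝 ((1 + 4 * cos θ ^ 2) / sin θ ^ 7 * (θ / 2)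
        - cos θ * (13 + 2 * cos θ ^ 2) / (6 * sin θ ^ 6) * 1
        + (3 + 2 * cos θ ^ 2) / (6 * sin θ ^ 4) * 0 - cos θ / (3 * sin θ ^ 2) * 0)) := by
    have ha : Tendsto (fun v => arctan (sin θ / (1 + cos θ) * (sinh v / (cosh v + 1)))) atTop
        (𝓝 (θ / 2)) := by
      have := (continuous_arctan.tendsto _).comp
        ((tendsto_sinh_div_cosh_add 1).const_mul (sin θ / (1 + cos θ)))
      rwa [mul_one, hhalf, arctan_tan (by linarith [hθ.1, pi_pos])
        (by linarith [hθ.1, hθ.2]), ← hhalf] at this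
    have h1 : Tendsto (fun v => sinh v / (cosh v + cos θ) ^ (0 + 1)) atTop (𝓝 1) := by
      simpa only [zero_add, pow_one] using tendsto_sinh_div_cosh_add (cos θ)
    exact (((ha.const_mul _).sub (h1.const_mul _)).add
      ((tendsto_sinh_div_cosh_add_pow (cos θ) 0).const_mul _)).sub
      ((tendsto_sinh_div_cosh_add_pow (cos θ) 1).const_mul _)
  have h0 : coshPrimitive θ 0 = 0 := by simp [coshPrimitive]
  rw [coshIntegral, integral_Ioi_of_hasDerivAt_of_nonneg' (g := coshPrimitive θ)
    (fun v _ => hasDerivAt_coshPrimitive hθ v)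
    (fun v _ => by have := cosh_pos v; positivity) hlim, h0]
  field_simp
  ring

/-! ### Derivatives of `sinh z / z` -/

/-- The moments `∫₀¹ rⁿ exp (z r) dr`; the function `psi` is the even part of the zeroth one. -/
noncomputable def expMoment (n : ℕ) (z : ℝ) : ℝ := ∫ r in (0 : ℝ)..1, r ^ n * exp (z * r)

lemma hasDerivAt_expMoment (n : ℕ) (z : ℝ) :
    HasDerivAt (expMoment n) (expMoment (n + 1) z) z := by
  refine (intervalIntegral.hasDerivAt_integral_of_dominated_loc_of_deriv_le
    (F' := fun x r => r ^ (n + 1) * exp (x * r)) (bound := fun _ => exp (|z| + 1))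
    (Metric.ball_mem_nhds z one_pos) ?_ ?_ ?_ ?_ ?_ ?_).2
  · exact Eventually.of_forall fun x => (by fun_prop : Continuous _).aestronglyMeasurable
  · exact (by fun_prop : Continuous fun r : ℝ => r ^ n * exp (z * r)).intervalIntegrable _ _
  · exact (by fun_prop : Continuous _).aestronglyMeasurable
  · refine Eventually.of_forall fun r hr x hx => ?_
    rw [uIoc_of_le zero_le_one] at hr
    have hxz : |x| ≤ |z| + 1 := by
      have h1 : |x - z| < 1 := by simpa [Real.dist_eq] using hx
      have h2 := abs_add_le (x - z) z
      rw [sub_add_cancel] at h2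
      linarith
    rw [norm_mul, norm_pow, norm_of_nonneg hr.1.le, norm_of_nonneg (exp_pos _).le]
    have h3 : x * r ≤ |z| + 1 := by
      have : x * r ≤ |x| * r := mul_le_mul_of_nonneg_right (le_abs_self x) hr.1.le
      have : |x| * r ≤ |x| := mul_le_of_le_one_right (abs_nonneg x) hr.2
      linarith
    calc r ^ (n + 1) * exp (x * r) ≤ 1 * exp (|z| + 1) := by
          gcongr
          exact pow_le_one₀ hr.1.le hr.2
      _ = _ := one_mul _
  · exact intervalIntegrable_const
  · refine Eventually.of_forall fun r _ x _ => ?_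
    refine ((((hasDerivAt_id x).mul_const r).exp).const_mul (r ^ n)).congr_deriv ?_
    simp only [id]
    ring

lemma expMoment_nonneg (n : ℕ) (z : ℝ) : 0 ≤ expMoment n z :=
  intervalIntegral.integral_nonneg zero_le_one fun r hr => by
    have := hr.1
    positivity

lemma expMoment_le (n : ℕ) (z : ℝ) : expMoment n z ≤ exp |z| := by
  have h : expMoment n z ≤ ∫ _ in (0 : ℝ)..1, exp |z| := by
    refine intervalIntegral.integral_mono_on zero_le_one
      ((by fun_prop : Continuous fun r : ℝ => r ^ n * exp (z * r)).intervalIntegrable _ _)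
      intervalIntegrable_const fun r hr => ?_
    have h3 : z * r ≤ |z| := by
      have : z * r ≤ |z| * r := mul_le_mul_of_nonneg_right (le_abs_self z) hr.1
      have : |z| * r ≤ |z| := mul_le_of_le_one_right (abs_nonneg z) hr.2
      linarith
    calc r ^ n * exp (z * r) ≤ 1 * exp |z| := by
          gcongr
          exact pow_le_one₀ hr.1 hr.2
      _ = _ := one_mul _
  simpa using h

lemma expMoment_zero_right (n : ℕ) : expMoment n 0 = 1 / (n + 1) := by
  simp [expMoment]

lemma psi_eq_expMoment (z : ℝ) : psi z = (expMoment 0 z + expMoment 0 (-z)) / 2 := by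
  rcases eq_or_ne z 0 with rfl | hz
  · simp [psi, expMoment_zero_right]
  · have h : ∀ w : ℝ, w ≠ 0 → expMoment 0 w = (exp w - 1) / w := by
      intro w hw
      have := intervalIntegral.integral_comp_mul_left (a := 0) (b := 1) (fun x => exp x) hw
      simp only [expMoment, pow_zero, one_mul, this, integral_exp]
      simp [div_eq_inv_mul]
    rw [h z hz, h (-z) (neg_ne_zero.2 hz), psi, if_neg hz, sinh_eq]
    field_simp
    ring

/-- The derivative of `psi`. -/
noncomputable def psiDeriv (z : ℝ) : ℝ := (expMoment 1 z - expMoment 1 (-z)) / 2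

/-- The second derivative of `psi`. -/
noncomputable def psiDeriv₂ (z : ℝ) : ℝ := (expMoment 2 z + expMoment 2 (-z)) / 2

lemma hasDerivAt_psi (z : ℝ) : HasDerivAt psi (psiDeriv z) z := by
  have h := ((hasDerivAt_expMoment 0 z).add
    ((hasDerivAt_expMoment 0 (-z)).comp z (hasDerivAt_neg z))).div_const 2
  rw [show psi = fun z => (expMoment 0 z + expMoment 0 (-z)) / 2 from funext psi_eq_expMoment]
  exact h.congr_deriv (by simp only [psiDeriv]; ring)

lemma hasDerivAt_psiDeriv (z : ℝ) : HasDerivAt psiDeriv (psiDeriv₂ z) z := by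
  have h := ((hasDerivAt_expMoment 1 z).sub
    ((hasDerivAt_expMoment 1 (-z)).comp z (hasDerivAt_neg z))).div_const 2
  exact h.congr_deriv (by simp only [psiDeriv₂]; ring)

lemma continuous_psi : Continuous psi :=
  continuous_iff_continuousAt.2 fun z => (hasDerivAt_psi z).continuousAt

lemma continuous_psiDeriv : Continuous psiDeriv :=
  continuous_iff_continuousAt.2 fun z => (hasDerivAt_psiDeriv z).continuousAt

lemma abs_psiDeriv_le (z : ℝ) : |psiDeriv z| ≤ exp |z| := by
  have h1 := expMoment_le 1 z
  have h2 := expMoment_le 1 (-z)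
  have h3 := expMoment_nonneg 1 z
  have h4 := expMoment_nonneg 1 (-z)
  rw [abs_neg] at h2
  rw [psiDeriv, abs_le]
  constructor <;> linarith

lemma abs_psiDeriv₂_le (z : ℝ) : |psiDeriv₂ z| ≤ exp |z| := by
  have h1 := expMoment_le 2 z
  have h2 := expMoment_le 2 (-z)
  have h3 := expMoment_nonneg 2 z
  have h4 := expMoment_nonneg 2 (-z)
  rw [abs_neg] at h2
  rw [psiDeriv₂, abs_le]
  constructor <;> linarith

/-- This bounds the integrand of `F` and its derivatives by their Bessel factors at `s = 0`, as the
moments of `K₀` are decreasing. -/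
lemma one_le_psi (z : ℝ) : 1 ≤ psi z := by
  have key : ∀ w : ℝ, 0 < w → 1 ≤ sinh w / w := fun w hw => by
    rw [le_div_iff₀ hw, one_mul]
    exact self_le_sinh_iff.2 hw.le
  unfold psi
  split_ifs with h
  · exact le_rfl
  · rcases lt_or_gt_of_ne h with h | h
    · have := key (-z) (by linarith)
      rwa [sinh_neg, neg_div_neg_eq] at this
    · exact key z h

/-! ### Derivatives and Laplace transforms of `K₀` -/

/-- The function `∫₀^∞ coshⁿ v exp (-z cosh v) dv`, which is `(-1)ⁿ` times the `n`-th derivative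
of `K₀`. -/
noncomputable def coshMoment (n : ℕ) (z : ℝ) : ℝ :=
  ∫ v in Ioi (0 : ℝ), cosh v ^ n * exp (-z * cosh v)

lemma besselK_zero (z : ℝ) : besselK 0 z = coshMoment 0 z := by
  simp [besselK, coshMoment]

lemma inv_cosh_le (v : ℝ) : (cosh v)⁻¹ ≤ 2 * exp (-v) := by
  rw [inv_le_iff_one_le_mul₀ (cosh_pos v), cosh_eq]
  have h : exp (-v) * exp v = 1 := by rw [← exp_add]; simp
  nlinarith [sq_nonneg (exp (-v))]

lemma integrableOn_two_mul_exp_neg : IntegrableOn (fun v : ℝ => 2 * exp (-v)) (Ioi 0) :=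
  (integrableOn_exp_neg_Ioi 0).const_mul 2

lemma cosh_pow_mul_exp_le (n : ℕ) {z : ℝ} (hz : 0 < z) (v : ℝ) :
    cosh v ^ n * exp (-z * cosh v) ≤ ((n + 1).factorial / z ^ (n + 1)) * (2 * exp (-v)) := by
  have hC := cosh_pos v
  have h := pow_div_factorial_le_exp (z * cosh v) (by positivity) (n + 1)
  refine le_trans ?_ (mul_le_mul_of_nonneg_left (inv_cosh_le v) (by positivity))
  rw [neg_mul, exp_neg]
  have hf : (0 : ℝ) < (n + 1).factorial := by positivity
  rw [div_le_iff₀ hf] at h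
  rw [← div_eq_mul_inv, ← div_eq_mul_inv, div_div, div_le_div_iff₀ (exp_pos _) (by positivity)]
  calc cosh v ^ n * (z ^ (n + 1) * cosh v) = (z * cosh v) ^ (n + 1) := by ring
    _ ≤ _ := by linarith

lemma integrableOn_cosh_pow_mul_exp (n : ℕ) {z : ℝ} (hz : 0 < z) :
    IntegrableOn (fun v => cosh v ^ n * exp (-z * cosh v)) (Ioi 0) := by
  refine (integrableOn_two_mul_exp_neg.const_mul ((n + 1).factorial / z ^ (n + 1))).mono'
    (by fun_prop : Continuous _).aestronglyMeasurable (Eventually.of_forall fun v => ?_)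
  have hC := cosh_pos v
  rw [norm_of_nonneg (by positivity)]
  exact cosh_pow_mul_exp_le n hz v

lemma coshMoment_nonneg (n : ℕ) (z : ℝ) : 0 ≤ coshMoment n z :=
  integral_nonneg fun v => by have := cosh_pos v; positivity

lemma coshMoment_anti (n : ℕ) {z w : ℝ} (hz : 0 < z) (hzw : z ≤ w) :
    coshMoment n w ≤ coshMoment n z := by
  refine integral_mono (integrableOn_cosh_pow_mul_exp n (hz.trans_le hzw))
    (integrableOn_cosh_pow_mul_exp n hz) fun v => ?_
  have hC := cosh_pos v
  simp only
  gcongr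

lemma hasDerivAt_coshMoment (n : ℕ) {z : ℝ} (hz : 0 < z) :
    HasDerivAt (coshMoment n) (-coshMoment (n + 1) z) z := by
  have h := (hasDerivAt_integral_of_dominated_loc_of_deriv_le
    (μ := volume.restrict (Ioi (0 : ℝ))) (F := fun z v => cosh v ^ n * exp (-z * cosh v))
    (F' := fun z v => -(cosh v ^ (n + 1) * exp (-z * cosh v)))
    (bound := fun v => cosh v ^ (n + 1) * exp (-(z / 2) * cosh v))
    (Ioi_mem_nhds (half_lt_self hz)) ?_ (integrableOn_cosh_pow_mul_exp n hz) ?_ ?_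
    (integrableOn_cosh_pow_mul_exp (n + 1) (half_pos hz)) ?_).2
  · rwa [integral_neg] at h
  · exact Eventually.of_forall fun x => (by fun_prop : Continuous _).aestronglyMeasurable
  · exact (by fun_prop : Continuous _).aestronglyMeasurable
  · refine Eventually.of_forall fun v x hx => ?_
    have hC := cosh_pos v
    have hx' : z / 2 ≤ x := le_of_lt hx
    rw [norm_neg, norm_of_nonneg (by positivity)]
    gcongr
  · refine Eventually.of_forall fun v x _ => ?_
    refine (((hasDerivAt_neg x).mul_const (cosh v)).exp.const_mul (cosh v ^ n)).congr_deriv ?_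
    ring

lemma continuousOn_coshMoment (n : ℕ) : ContinuousOn (coshMoment n) (Ioi 0) :=
  fun _ hz => (hasDerivAt_coshMoment n hz).continuousAt.continuousWithinAt

lemma integral_pow_mul_exp_neg (n : ℕ) {r : ℝ} (hr : 0 < r) :
    ∫ t in Ioi (0 : ℝ), t ^ n * exp (-(r * t)) = n.factorial / r ^ (n + 1) := by
  have h := integral_rpow_mul_exp_neg_mul_Ioi (a := n + 1) (by positivity) hr
  rw [Gamma_nat_eq_factorial] at h
  simp only [add_sub_cancel_right, rpow_natCast] at h
  rw [h, show ((n : ℝ) + 1) = ((n + 1 : ℕ) : ℝ) by push_cast; ring, rpow_natCast,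
    one_div, inv_pow]
  field_simp

lemma integrableOn_pow_mul_exp_neg (n : ℕ) {r : ℝ} (hr : 0 < r) :
    IntegrableOn (fun t : ℝ => t ^ n * exp (-(r * t))) (Ioi 0) :=
  .of_integral_ne_zero (by rw [integral_pow_mul_exp_neg n hr]; positivity)

/-- The condition `k ≤ n` makes the double integral converge at `t = 0`, where
`coshMoment k (a t)` blows up like `t⁻ᵏ` (logarithmically for `k = 0`). -/
lemma integrable_prod_laplace {n k : ℕ} (hk : k ≤ n) {a b : ℝ} (ha : 0 < a) (hb : 0 < b) :
    Integrable (Function.uncurry fun t v : ℝ => t ^ n * exp (-b * t) *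
      (cosh v ^ k * exp (-(a * t) * cosh v)))
      ((volume.restrict (Ioi 0)).prod (volume.restrict (Ioi 0))) := by
  have hrew : ∀ t v : ℝ, t ^ n * exp (-b * t) * (cosh v ^ k * exp (-(a * t) * cosh v))
      = cosh v ^ k * (t ^ n * exp (-((a * cosh v + b) * t))) := by
    intro t v
    rw [show -((a * cosh v + b) * t) = -b * t + -(a * t) * cosh v by ring, exp_add]
    ring
  have hr : ∀ v : ℝ, 0 < a * cosh v + b := fun v => by have := cosh_pos v; positivity
  rw [integrable_prod_iff' (by
    unfold Function.uncurry
    exact (by fun_prop : Continuous _).aestronglyMeasurable)]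
  refine ⟨Eventually.of_forall fun v => ?_, ?_⟩
  · simp only [Function.uncurry, hrew]
    exact (integrableOn_pow_mul_exp_neg n (hr v)).const_mul _
  · have hinner : ∀ v : ℝ, ∫ t in Ioi (0 : ℝ), ‖Function.uncurry (fun t v : ℝ =>
        t ^ n * exp (-b * t) * (cosh v ^ k * exp (-(a * t) * cosh v))) (t, v)‖
        = cosh v ^ k * (n.factorial / (a * cosh v + b) ^ (n + 1)) := by
      intro v
      rw [← integral_pow_mul_exp_neg n (hr v), ← integral_const_mul]
      refine setIntegral_congr_fun measurableSet_Ioi fun t ht => ?_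
      have ht' : 0 < t := ht
      have := cosh_pos v
      simp only [Function.uncurry, hrew]
      exact norm_of_nonneg (by positivity)
    simp only [hinner]
    have hcont : Continuous fun v => cosh v ^ k * (n.factorial / (a * cosh v + b) ^ (n + 1)) := by
      refine (by fun_prop : Continuous _).mul (continuous_const.div (by fun_prop) fun v => ?_)
      exact pow_ne_zero _ (hr v).ne'
    refine (integrableOn_two_mul_exp_neg.const_mul (n.factorial / a ^ (n + 1))).mono'
      hcont.aestronglyMeasurable (Eventually.of_forall fun v => ?_)
    have hC := cosh_pos v
    have hr' := hr v
    rw [norm_of_nonneg (by positivity)]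
    refine le_trans ?_ (mul_le_mul_of_nonneg_left (inv_cosh_le v) (by positivity))
    calc cosh v ^ k * (n.factorial / (a * cosh v + b) ^ (n + 1))
        ≤ cosh v ^ n * (n.factorial / (a * cosh v) ^ (n + 1)) := by
          gcongr
          · exact one_le_cosh v
          · linarith
      _ = n.factorial / a ^ (n + 1) * (cosh v)⁻¹ := by
          field_simp
          ring

lemma integrableOn_laplace_coshMoment {n k : ℕ} (hk : k ≤ n) {a b : ℝ} (ha : 0 < a)
    (hb : 0 < b) :
    IntegrableOn (fun t => t ^ n * exp (-b * t) * coshMoment k (a * t)) (Ioi 0) := by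
  have h := (integrable_prod_laplace hk ha hb).integral_prod_left
  simp only [Function.uncurry, integral_const_mul] at h
  exact h

lemma integral_laplace_coshMoment {n k : ℕ} (hk : k ≤ n) {a b : ℝ} (ha : 0 < a)
    (hb : 0 < b) :
    ∫ t in Ioi (0 : ℝ), t ^ n * exp (-b * t) * coshMoment k (a * t)
      = ∫ v in Ioi (0 : ℝ), cosh v ^ k * (n.factorial / (a * cosh v + b) ^ (n + 1)) := by
  have h := integral_integral_swap (integrable_prod_laplace hk ha hb)
  simp only [integral_const_mul] at h
  refine h.trans (setIntegral_congr_fun measurableSet_Ioi fun v _ => ?_)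
  have hr : 0 < a * cosh v + b := by have := cosh_pos v; positivity
  rw [← integral_pow_mul_exp_neg n hr, ← integral_const_mul]
  refine setIntegral_congr_fun measurableSet_Ioi fun t _ => ?_
  rw [show -((a * cosh v + b) * t) = -b * t + -(a * t) * cosh v by ring, exp_add]
  ring

/-! ### The second derivative of `F` in `s` at `s = 0` -/

/-- The `s`-derivative of the integrand of `F`, with `a = 2 y` and `b = 2 x`. -/
noncomputable def integrandDeriv (a b s t : ℝ) : ℝ :=
  -coshMoment 1 (a * t * psi (s * t)) * (a * t ^ 2 * psiDeriv (s * t)) * exp (-b * t)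

/-- The second `s`-derivative of the integrand of `F`, with `a = 2 y` and `b = 2 x`. -/
noncomputable def integrandDeriv₂ (a b s t : ℝ) : ℝ :=
  (coshMoment 2 (a * t * psi (s * t)) * (a * t ^ 2 * psiDeriv (s * t)) ^ 2
    - coshMoment 1 (a * t * psi (s * t)) * (a * t ^ 3 * psiDeriv₂ (s * t))) * exp (-b * t)

lemma le_mul_psi {a t : ℝ} (ha : 0 < a) (ht : 0 < t) (s : ℝ) :
    a * t ≤ a * t * psi (s * t) :=
  le_mul_of_one_le_right (by positivity) (one_le_psi _)

lemma hasDerivAt_mul_psi (a t s : ℝ) :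
    HasDerivAt (fun s => a * t * psi (s * t)) (a * t ^ 2 * psiDeriv (s * t)) s := by
  refine (((hasDerivAt_psi (s * t)).comp s
    ((hasDerivAt_id s).mul_const t)).const_mul (a * t)).congr_deriv ?_
  ring

lemma hasDerivAt_integrand {a t : ℝ} (ha : 0 < a) (ht : 0 < t) (b s : ℝ) :
    HasDerivAt (fun s => coshMoment 0 (a * t * psi (s * t)) * exp (-b * t))
      (integrandDeriv a b s t) s := by
  have hpos : 0 < a * t * psi (s * t) := (by positivity : 0 < a * t).trans_le (le_mul_psi ha ht s)
  exact ((hasDerivAt_coshMoment 0 hpos).comp s (hasDerivAt_mul_psi a t s)).mul_const _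

lemma hasDerivAt_integrandDeriv {a t : ℝ} (ha : 0 < a) (ht : 0 < t) (b s : ℝ) :
    HasDerivAt (fun s => integrandDeriv a b s t) (integrandDeriv₂ a b s t) s := by
  have hpos : 0 < a * t * psi (s * t) := (by positivity : 0 < a * t).trans_le (le_mul_psi ha ht s)
  have h1 := ((hasDerivAt_coshMoment 1 hpos).comp s (hasDerivAt_mul_psi a t s)).neg
  have h2 := ((hasDerivAt_psiDeriv (s * t)).comp s
    ((hasDerivAt_id s).mul_const t)).const_mul (a * t ^ 2)
  refine ((h1.mul h2).mul_const (exp (-b * t))).congr_deriv ?_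
  simp only [integrandDeriv₂, Pi.neg_apply, Function.comp_apply, id]
  ring

lemma continuousOn_coshMoment_mul_psi (n : ℕ) {a : ℝ} (ha : 0 < a) (s : ℝ) :
    ContinuousOn (fun t => coshMoment n (a * t * psi (s * t))) (Ioi 0) := by
  refine (continuousOn_coshMoment n).comp ?_ fun t (ht : 0 < t) =>
    (by positivity : 0 < a * t).trans_le (le_mul_psi ha ht s)
  exact ((continuous_const.mul continuous_id).mul
    (continuous_psi.comp (continuous_const.mul continuous_id))).continuousOn

lemma aestronglyMeasurable_integrand {a : ℝ} (ha : 0 < a) (b s : ℝ) :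
    AEStronglyMeasurable (fun t => coshMoment 0 (a * t * psi (s * t)) * exp (-b * t))
      (volume.restrict (Ioi 0)) :=
  ((continuousOn_coshMoment_mul_psi 0 ha s).mul
    (by fun_prop : Continuous fun t : ℝ => exp (-b * t)).continuousOn).aestronglyMeasurable
    measurableSet_Ioi

lemma aestronglyMeasurable_integrandDeriv {a : ℝ} (ha : 0 < a) (b s : ℝ) :
    AEStronglyMeasurable (integrandDeriv a b s) (volume.restrict (Ioi 0)) := by
  have h : Continuous fun t => psiDeriv (s * t) := continuous_psiDeriv.comp (by fun_prop)
  exact (((continuousOn_coshMoment_mul_psi 1 ha s).neg.mul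
    (by fun_prop : Continuous fun t : ℝ => a * t ^ 2 * psiDeriv (s * t)).continuousOn).mul
    (by fun_prop : Continuous fun t : ℝ => exp (-b * t)).continuousOn).aestronglyMeasurable
    measurableSet_Ioi

lemma integrableOn_integrand {a b : ℝ} (ha : 0 < a) (hb : 0 < b) (s : ℝ) :
    IntegrableOn (fun t => coshMoment 0 (a * t * psi (s * t)) * exp (-b * t)) (Ioi 0) := by
  refine (integrableOn_laplace_coshMoment (n := 0) (k := 0) le_rfl ha hb).mono'
    (aestronglyMeasurable_integrand ha b s) ?_
  filter_upwards [ae_restrict_mem measurableSet_Ioi] with t ht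
  have ht' : 0 < t := ht
  have h0 := coshMoment_nonneg 0 (a * t * psi (s * t))
  have h1 := coshMoment_anti 0 (by positivity) (le_mul_psi ha ht' s)
  rw [norm_of_nonneg (by positivity), pow_zero, one_mul, mul_comm]
  gcongr

lemma abs_mul_le_of_mem_ball {ε s t : ℝ} (hs : s ∈ Metric.ball (0 : ℝ) ε) (ht : 0 < t) :
    |s * t| ≤ ε * t := by
  have : |s| < ε := by simpa using hs
  rw [abs_mul, abs_of_pos ht]
  gcongr

lemma abs_integrandDeriv_le {a b s t ε : ℝ} (ha : 0 < a) (hs : s ∈ Metric.ball (0 : ℝ) ε)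
    (ht : 0 < t) :
    ‖integrandDeriv a b s t‖ ≤ a * (t ^ 2 * exp (-(b - ε) * t) * coshMoment 1 (a * t)) := by
  have h0 := coshMoment_nonneg 1 (a * t * psi (s * t))
  have h0' := coshMoment_nonneg 1 (a * t)
  have h1 := coshMoment_anti 1 (by positivity) (le_mul_psi ha ht s)
  have h2 : |psiDeriv (s * t)| ≤ exp (ε * t) :=
    (abs_psiDeriv_le _).trans (exp_le_exp.2 (abs_mul_le_of_mem_ball hs ht))
  have e : |integrandDeriv a b s t| = coshMoment 1 (a * t * psi (s * t))
      * (a * t ^ 2 * |psiDeriv (s * t)|) * exp (-b * t) := by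
    rw [integrandDeriv, abs_mul, abs_mul, abs_neg, abs_of_nonneg h0, abs_mul,
      abs_of_pos (by positivity : 0 < a * t ^ 2), abs_of_pos (exp_pos _)]
  rw [norm_eq_abs, e]
  calc _ ≤ coshMoment 1 (a * t) * (a * t ^ 2 * exp (ε * t)) * exp (-b * t) := by gcongr
    _ = _ := by
      rw [show -(b - ε) * t = ε * t + -b * t by ring, exp_add]
      ring

lemma abs_integrandDeriv₂_le {a b s t ε : ℝ} (ha : 0 < a) (hs : s ∈ Metric.ball (0 : ℝ) ε)
    (ht : 0 < t) :
    ‖integrandDeriv₂ a b s t‖ ≤ a ^ 2 * (t ^ 4 * exp (-(b - 2 * ε) * t) * coshMoment 2 (a * t))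
      + a * (t ^ 3 * exp (-(b - ε) * t) * coshMoment 1 (a * t)) := by
  have h0 := coshMoment_nonneg 1 (a * t * psi (s * t))
  have h0' := coshMoment_nonneg 1 (a * t)
  have h1 := coshMoment_anti 1 (by positivity) (le_mul_psi ha ht s)
  have h3 := coshMoment_nonneg 2 (a * t * psi (s * t))
  have h3' := coshMoment_nonneg 2 (a * t)
  have h4 := coshMoment_anti 2 (by positivity) (le_mul_psi ha ht s)
  have h2 : |psiDeriv (s * t)| ≤ exp (ε * t) :=
    (abs_psiDeriv_le _).trans (exp_le_exp.2 (abs_mul_le_of_mem_ball hs ht))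
  have h5 : |psiDeriv₂ (s * t)| ≤ exp (ε * t) :=
    (abs_psiDeriv₂_le _).trans (exp_le_exp.2 (abs_mul_le_of_mem_ball hs ht))
  have e1 : |coshMoment 2 (a * t * psi (s * t)) * (a * t ^ 2 * psiDeriv (s * t)) ^ 2|
      = coshMoment 2 (a * t * psi (s * t)) * (a * t ^ 2 * |psiDeriv (s * t)|) ^ 2 := by
    rw [abs_mul, abs_of_nonneg h3, abs_pow, abs_mul, abs_of_pos (by positivity : 0 < a * t ^ 2)]
  have e2 : |coshMoment 1 (a * t * psi (s * t)) * (a * t ^ 3 * psiDeriv₂ (s * t))|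
      = coshMoment 1 (a * t * psi (s * t)) * (a * t ^ 3 * |psiDeriv₂ (s * t)|) := by
    rw [abs_mul, abs_of_nonneg h0, abs_mul, abs_of_pos (by positivity : 0 < a * t ^ 3)]
  rw [norm_eq_abs, integrandDeriv₂, abs_mul, abs_of_pos (exp_pos _)]
  calc _ ≤ (coshMoment 2 (a * t * psi (s * t)) * (a * t ^ 2 * |psiDeriv (s * t)|) ^ 2
        + coshMoment 1 (a * t * psi (s * t)) * (a * t ^ 3 * |psiDeriv₂ (s * t)|))
          * exp (-b * t) := by
        rw [← e1, ← e2]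
        gcongr
        exact abs_sub _ _
    _ ≤ (coshMoment 2 (a * t) * (a * t ^ 2 * exp (ε * t)) ^ 2
        + coshMoment 1 (a * t) * (a * t ^ 3 * exp (ε * t))) * exp (-b * t) := by gcongr
    _ = _ := by
      rw [show -(b - ε) * t = ε * t + -b * t by ring,
        show -(b - 2 * ε) * t = ε * t + ε * t + -b * t by ring, exp_add, exp_add, exp_add]
      ring

/-- For `|s| < b / 4` the derivatives of `psi (s t)` are at most `exp (b t / 4)`, and such a factor,
even squared, is absorbed by `exp (-b t)`; this is why the ball has radius `b / 4`. -/
lemma hasDerivAt_integral_integrand {a b s : ℝ} (ha : 0 < a) (hb : 0 < b)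
    (hs : s ∈ Metric.ball (0 : ℝ) (b / 4)) :
    IntegrableOn (integrandDeriv a b s) (Ioi 0) ∧
    HasDerivAt (fun s => ∫ t in Ioi (0 : ℝ), coshMoment 0 (a * t * psi (s * t)) * exp (-b * t))
      (∫ t in Ioi (0 : ℝ), integrandDeriv a b s t) s := by
  refine hasDerivAt_integral_of_dominated_loc_of_deriv_le
    (bound := fun t => a * (t ^ 2 * exp (-(b - b / 4) * t) * coshMoment 1 (a * t)))
    (Metric.isOpen_ball.mem_nhds hs)
    (Eventually.of_forall (aestronglyMeasurable_integrand ha b))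
    (integrableOn_integrand ha hb s) (aestronglyMeasurable_integrandDeriv ha b s) ?_
    ((integrableOn_laplace_coshMoment one_le_two ha (by linarith)).const_mul a) ?_
  · filter_upwards [ae_restrict_mem measurableSet_Ioi] with t ht x hx
      using abs_integrandDeriv_le ha hx ht
  · filter_upwards [ae_restrict_mem measurableSet_Ioi] with t ht x _
      using hasDerivAt_integrand ha ht b x

lemma integrandDeriv₂_zero (a b t : ℝ) :
    integrandDeriv₂ a b 0 t = -(a / 3) * (t ^ 3 * exp (-b * t) * coshMoment 1 (a * t)) := by
  have h1 : psi 0 = 1 := if_pos rfl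
  have h2 : psiDeriv 0 = 0 := by simp [psiDeriv]
  have h3 : psiDeriv₂ 0 = 1 / 3 := by
    simp only [psiDeriv₂, neg_zero, expMoment_zero_right]
    norm_num
  simp only [integrandDeriv₂, zero_mul, h1, h2, h3, mul_one]
  ring

lemma hasDerivAt_integral_integrandDeriv {a b : ℝ} (ha : 0 < a) (hb : 0 < b) :
    HasDerivAt (fun s => ∫ t in Ioi (0 : ℝ), integrandDeriv a b s t)
      (∫ t in Ioi (0 : ℝ), integrandDeriv₂ a b 0 t) 0 := by
  have hb4 : 0 < b / 4 := by positivity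
  have hm : (0 : ℝ) ∈ Metric.ball (0 : ℝ) (b / 4) := Metric.mem_ball_self hb4
  have hint₁ : IntegrableOn (fun t => t ^ 3 * exp (-b * t) * coshMoment 1 (a * t)) (Ioi 0) :=
    integrableOn_laplace_coshMoment (by norm_num) ha hb
  refine (hasDerivAt_integral_of_dominated_loc_of_deriv_le
    (bound := fun t =>
      a ^ 2 * (t ^ 4 * exp (-(b - 2 * (b / 4)) * t) * coshMoment 2 (a * t))
      + a * (t ^ 3 * exp (-(b - b / 4) * t) * coshMoment 1 (a * t)))
    (Metric.isOpen_ball.mem_nhds hm)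
    (Eventually.of_forall (aestronglyMeasurable_integrandDeriv ha b))
    (hasDerivAt_integral_integrand ha hb hm).1 ?_ ?_
    (((integrableOn_laplace_coshMoment (by norm_num) ha (by linarith)).const_mul (a ^ 2)).add
      ((integrableOn_laplace_coshMoment (by norm_num) ha (by linarith)).const_mul a)) ?_).2
  · rw [show integrandDeriv₂ a b 0 = fun t => -(a / 3) *
      (t ^ 3 * exp (-b * t) * coshMoment 1 (a * t)) from funext (integrandDeriv₂_zero a b)]
    exact (hint₁.const_mul _).aestronglyMeasurable
  · filter_upwards [ae_restrict_mem measurableSet_Ioi] with t ht x hx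
      using abs_integrandDeriv₂_le ha hx ht
  · filter_upwards [ae_restrict_mem measurableSet_Ioi] with t ht x _
      using hasDerivAt_integrandDeriv ha ht b x

/-- With `x = y cos θ`, the Laplace transform of `t³ K₁(2 y t)` at `2 x` becomes an integral of
`cosh v (2 y cosh v + 2 x)⁻⁴`, which scales to `coshIntegral θ`. -/
lemma iteratedDeriv_two_F {θ : ℝ} (hθ : θ ∈ Ioo 0 (π / 2)) {x y : ℝ} (hy : 0 < y)
    (hxy : x = y * cos θ) :
    iteratedDeriv 2 (fun s => F y x s) 0 = -(coshIntegral θ / (2 * y ^ 2)) := by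
  have hc : 0 < cos θ := cos_pos_of_mem_Ioo ⟨by linarith [hθ.1, pi_pos], hθ.2⟩
  have hx : 0 < x := by rw [hxy]; positivity
  have ha : 0 < 2 * y := by positivity
  have hb : 0 < 2 * x := by positivity
  have hF : (fun s => F y x s) = fun s => 2 * y *
      ∫ t in Ioi (0 : ℝ), coshMoment 0 (2 * y * t * psi (s * t)) * exp (-(2 * x) * t) := by
    ext s
    simp only [F, besselK_zero, neg_mul, mul_comm _ (2 * y)]
  have hev : deriv (fun s => F y x s) =ᶠ[𝓝 0]
      fun s => 2 * y * ∫ t in Ioi (0 : ℝ), integrandDeriv (2 * y) (2 * x) s t := by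
    filter_upwards [Metric.ball_mem_nhds (0 : ℝ) (show 0 < 2 * x / 4 by positivity)] with s hs
    rw [hF]
    exact ((hasDerivAt_integral_integrand ha hb hs).2.const_mul (2 * y)).deriv
  rw [iteratedDeriv_succ, iteratedDeriv_one, hev.deriv_eq,
    ((hasDerivAt_integral_integrandDeriv ha hb).const_mul (2 * y)).deriv]
  simp only [integrandDeriv₂_zero]
  rw [integral_const_mul, integral_laplace_coshMoment (by norm_num) ha hb, coshIntegral,
    ← integral_const_mul, ← integral_const_mul, ← integral_div, ← integral_neg]
  refine setIntegral_congr_fun measurableSet_Ioi fun v _ => ?_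
  have hC := cosh_pos v
  have hD : 0 < cosh v + cos θ := by positivity
  simp only [Nat.factorial]
  rw [hxy, show 2 * y * cosh v + 2 * (y * cos θ) = 2 * y * (cosh v + cos θ) by ring]
  push_cast
  field_simp
  norm_num

/-! ### Closed forms of `Θ₀` and `ζ` -/

lemma eq_pi_mul_cos_div {x : ℝ} (hx : 0 < x) :
    x = π * cos (coangle x) / (sin (coangle x) - coangle x * cos (coangle x)) := by
  rw [mul_div_assoc]
  exact (coangle_spec hx).2.symm

lemma iota_eq_pi_div {x : ℝ} (hx : 0 < x) :
    iota x = π / (sin (coangle x) - coangle x * cos (coangle x)) := by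
  have hθ := (coangle_spec hx).1
  have hc : 0 < cos (coangle x) := cos_pos_of_mem_Ioo ⟨by linarith [hθ.1, pi_pos], hθ.2⟩
  have h1 := sin_sub_mul_cos_pos hθ.1 hθ.2
  rw [iota_eq hx, div_eq_iff hc.ne', div_mul_eq_mul_div]
  exact eq_pi_mul_cos_div hx

lemma f_div_sqrt {x : ℝ} (hx : 0 < x) : f x / √(f x ^ 2 - 1) = 1 / sin (coangle x) := by
  have hθ := (coangle_spec hx).1
  have hc : 0 < cos (coangle x) := cos_pos_of_mem_Ioo ⟨by linarith [hθ.1, pi_pos], hθ.2⟩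
  rw [f_eq hx, sqrt_inv_sq_sub_one hθ]
  field_simp

lemma Theta0_eq {x : ℝ} (hx : 0 < x) :
    Theta0 x = cos (coangle x) * (sin (coangle x) - coangle x * cos (coangle x)) ^ 2
        * (2 * sin (coangle x) + sin (coangle x) * cos (coangle x) ^ 2
          - 3 * coangle x * cos (coangle x)) / (8 * π * sin (coangle x) ^ 6)
      + sin (coangle x) * (sin (coangle x) - coangle x * cos (coangle x)) ^ 2
        * coshIntegral (coangle x) / π ^ 3 := by
  have hθ := (coangle_spec hx).1
  have hs : 0 < sin (coangle x) := sin_pos_of_pos_of_lt_pi hθ.1 (by linarith [hθ.2, pi_pos])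
  have hc : 0 < cos (coangle x) := cos_pos_of_mem_Ioo ⟨by linarith [hθ.1, pi_pos], hθ.2⟩
  have hd := sin_sub_mul_cos_pos hθ.1 hθ.2
  have hι := iota_eq_pi_div hx
  have hF := iteratedDeriv_two_F hθ (x := x) (y := iota x) (by rw [hι]; positivity)
    (by rw [iota_eq hx]; field_simp)
  have hinv : √(f x ^ 2 - 1) / f x = sin (coangle x) := by
    rw [← inv_div, f_div_sqrt hx, one_div, inv_inv]
  have hx2 : x ^ 2 = (π * cos (coangle x)
      / (sin (coangle x) - coangle x * cos (coangle x))) ^ 2 := by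
    rw [← eq_pi_mul_cos_div hx]
  rw [Theta0, hF, hinv, f_div_sqrt hx, f_eq hx, iteratedDeriv_two_g hθ, hι, hx2]
  field_simp
  ring

lemma Theta0_pos {x : ℝ} (hx : 0 < x) : 0 < Theta0 x := by
  have hθ := (coangle_spec hx).1
  have hs : 0 < sin (coangle x) := sin_pos_of_pos_of_lt_pi hθ.1 (by linarith [hθ.2, pi_pos])
  have hc : 0 < cos (coangle x) := cos_pos_of_mem_Ioo ⟨by linarith [hθ.1, pi_pos], hθ.2⟩
  have hd := sin_sub_mul_cos_pos hθ.1 hθ.2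
  have hn := two_mul_sin_add_sub_pos hθ.1 hθ.2
  have hJ := coshIntegral_nonneg hθ
  rw [Theta0_eq hx]
  positivity

lemma hasDerivAt_primitive_coangle {x : ℝ} (hx : 0 < x) :
    HasDerivAt (fun x => primitive (coangle x)) (Theta0 x) x := by
  have hθ := (coangle_spec hx).1
  have hs : 0 < sin (coangle x) := sin_pos_of_pos_of_lt_pi hθ.1 (by linarith [hθ.2, pi_pos])
  have hd := sin_sub_mul_cos_pos hθ.1 hθ.2
  refine ((hasDerivAt_primitive hs.ne').comp x (hasDerivAt_coangle hx)).congr_deriv ?_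
  rw [Theta0_eq hx, coshIntegral_eq hθ, inv_neg, neg_mul_neg, inv_div]
  field_simp

lemma tendsto_primitive_coangle_zero :
    Tendsto (fun x => primitive (coangle x)) (𝓝[>] 0) (𝓝 0) := by
  have h1 : ContinuousAt primitive (π / 2) := (hasDerivAt_primitive (by simp)).continuousAt
  have h2 : primitive (π / 2) = 0 := by simp [primitive]
  rw [ContinuousAt, h2] at h1
  exact h1.comp tendsto_coangle_zero

lemma strictMonoOn_primitive_coangle :
    StrictMonoOn (fun x => primitive (coangle x)) (Ioi 0) := by
  apply strictMonoOn_of_deriv_pos (convex_Ioi _)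
  · exact fun x hx => (hasDerivAt_primitive_coangle hx).continuousAt.continuousWithinAt
  · intro x hx
    rw [interior_Ioi] at hx
    rw [(hasDerivAt_primitive_coangle hx).deriv]
    exact Theta0_pos hx

/-- Since `Θ₀` is nonnegative and has a primitive that extends continuously to `0`, it is
integrable down to `0`. -/
lemma integral_Theta0 {x : ℝ} (hx : 0 < x) :
    IntervalIntegrable Theta0 volume 0 x ∧
      ∫ t in (0 : ℝ)..x, Theta0 t = primitive (coangle x) := by
  have hderiv : ∀ t, 0 < t →
      HasDerivAt (Function.update (fun x => primitive (coangle x)) 0 0) (Theta0 t) t := by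
    intro t ht
    refine (hasDerivAt_primitive_coangle ht).congr_of_eventuallyEq ?_
    filter_upwards [lt_mem_nhds ht] with u hu
    exact Function.update_of_ne hu.ne' _ _
  have hcont : ContinuousOn (Function.update (fun x => primitive (coangle x)) 0 0)
      (Icc 0 x) := by
    intro t ht
    rcases ht.1.eq_or_lt with rfl | h
    · rw [continuousWithinAt_update_same]
      refine tendsto_primitive_coangle_zero.mono_left (nhdsWithin_mono _ ?_)
      rintro u ⟨hu, hu'⟩
      exact lt_of_le_of_ne hu.1 (Ne.symm hu')
    · exact (hderiv t h).continuousAt.continuousWithinAt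
  have hint : IntervalIntegrable Theta0 volume 0 x := by
    refine intervalIntegral.intervalIntegrable_deriv_of_nonneg
      (g := Function.update (fun x => primitive (coangle x)) 0 0) ?_ ?_ ?_
    · rwa [uIcc_of_le hx.le]
    · rw [min_eq_left hx.le]
      exact fun t ht => hderiv t ht.1
    · rw [min_eq_left hx.le]
      exact fun t ht => (Theta0_pos ht.1).le
  refine ⟨hint, ?_⟩
  rw [intervalIntegral.integral_eq_sub_of_hasDerivAt_of_le hx.le hcont
    (fun t ht => hderiv t ht.1) hint, Function.update_self, Function.update_of_ne hx.ne', sub_zero]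

lemma zeta_eq {x : ℝ} (hx : 0 < x) :
    zeta x = π / 4 * (1 / sin (coangle x)) * (1 / (2 * π ^ 2) - primitive (coangle x)) := by
  rw [zeta, f_div_sqrt hx, (integral_Theta0 hx).2]

/-! ### Limits and the zero of `ζ` -/

lemma continuousOn_zeta : ContinuousOn zeta (Ioi 0) := by
  intro x hx
  have hθ := (coangle_spec hx).1
  have hs : 0 < sin (coangle x) := sin_pos_of_pos_of_lt_pi hθ.1 (by linarith [hθ.2, pi_pos])
  have h1 : ContinuousAt (fun x => sin (coangle x)) x :=
    continuous_sin.continuousAt.comp (continuousAt_coangle hx)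
  have h2 := (hasDerivAt_primitive_coangle hx).continuousAt
  have h : ContinuousAt (fun x => π / 4 * (1 / sin (coangle x))
      * (1 / (2 * π ^ 2) - primitive (coangle x))) x :=
    (continuousAt_const.mul (continuousAt_const.div h1 hs.ne')).mul (continuousAt_const.sub h2)
  exact h.continuousWithinAt.congr (fun y hy => zeta_eq hy) (zeta_eq hx)

lemma tendsto_zeta_zero : Tendsto zeta (𝓝[>] 0) (𝓝 (1 / (8 * π))) := by
  have h1 : Tendsto (fun x => sin (coangle x)) (𝓝[>] 0) (𝓝 1) := by
    have := (continuous_sin.tendsto (π / 2)).comp tendsto_coangle_zero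
    rwa [sin_pi_div_two] at this
  have h : Tendsto (fun x => π / 4 * (1 / sin (coangle x))
      * (1 / (2 * π ^ 2) - primitive (coangle x))) (𝓝[>] 0)
      (𝓝 (π / 4 * (1 / 1) * (1 / (2 * π ^ 2) - 0))) :=
    ((tendsto_const_nhds.div h1 one_ne_zero).const_mul _).mul
      (tendsto_primitive_coangle_zero.const_sub _)
  have e : π / 4 * (1 / 1) * (1 / (2 * π ^ 2) - 0) = 1 / (8 * π) := by
    field_simp
    norm_num
  rw [e] at h
  refine h.congr' ?_
  filter_upwards [self_mem_nhdsWithin] with x hx using (zeta_eq hx).symm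

lemma tendsto_coangle_atTop : Tendsto coangle atTop (𝓝 0) := by
  refine tendsto_order.2 ⟨fun a ha => ?_, fun a ha => ?_⟩
  · filter_upwards [eventually_gt_atTop 0] with x hx
    exact ha.trans (coangle_spec hx).1.1
  · have hb : min a (π / 4) ∈ Ioo 0 (π / 2) :=
      ⟨lt_min ha (by positivity), min_lt_of_right_lt (by linarith [pi_pos])⟩
    have hp := ofCoangle_pos hb
    filter_upwards [eventually_gt_atTop (ofCoangle (min a (π / 4)))] with x hx
    have := strictAntiOn_coangle hp (hp.trans hx) hx
    rw [coangle_ofCoangle hb] at this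
    exact this.trans_le (min_le_left _ _)

lemma exists_primitive_coangle_gt :
    ∃ x, 0 < x ∧ 1 / (2 * π ^ 2) < primitive (coangle x) := by
  obtain ⟨θ, hθ, h⟩ := exists_primitive_gt
  exact ⟨ofCoangle θ, ofCoangle_pos hθ, by rwa [coangle_ofCoangle hθ]⟩

lemma tendsto_zeta_atTop : Tendsto zeta atTop atBot := by
  obtain ⟨x₁, hx₁, h₁⟩ := exists_primitive_coangle_gt
  have hsin : Tendsto (fun x => sin (coangle x)) atTop (𝓝[>] 0) := by
    refine tendsto_nhdsWithin_iff.2 ⟨?_, ?_⟩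
    · have := (continuous_sin.tendsto 0).comp tendsto_coangle_atTop
      rwa [sin_zero] at this
    · filter_upwards [eventually_gt_atTop 0] with x hx
      have hθ := (coangle_spec hx).1
      exact sin_pos_of_pos_of_lt_pi hθ.1 (by linarith [hθ.2, pi_pos])
  have hneg : π / 4 * (1 / (2 * π ^ 2) - primitive (coangle x₁)) < 0 :=
    mul_neg_of_pos_of_neg (by positivity) (by linarith)
  refine tendsto_atBot_mono' _ ?_ (hsin.inv_tendsto_nhdsGT_zero.const_mul_atTop_of_neg hneg)
  filter_upwards [eventually_ge_atTop x₁] with x hx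
  have hx0 : 0 < x := hx₁.trans_le hx
  have hθ := (coangle_spec hx0).1
  have hs : 0 < sin (coangle x) := sin_pos_of_pos_of_lt_pi hθ.1 (by linarith [hθ.2, pi_pos])
  have hmono : primitive (coangle x₁) ≤ primitive (coangle x) :=
    strictMonoOn_primitive_coangle.monotoneOn hx₁ hx0 hx
  rw [zeta_eq hx0, Pi.inv_apply, mul_right_comm, one_div (sin _)]
  gcongr

lemma zeta_eq_zero_iff {x : ℝ} (hx : 0 < x) :
    zeta x = 0 ↔ primitive (coangle x) = 1 / (2 * π ^ 2) := by
  have hθ := (coangle_spec hx).1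
  have hs : 0 < sin (coangle x) := sin_pos_of_pos_of_lt_pi hθ.1 (by linarith [hθ.2, pi_pos])
  have : π / 4 * (1 / sin (coangle x)) ≠ 0 := by positivity
  rw [zeta_eq hx, mul_eq_zero, or_iff_right this, sub_eq_zero, eq_comm]

lemma exists_zeta_eq_zero : ∃ x, 0 < x ∧ zeta x = 0 := by
  obtain ⟨x₁, hx₁, h₁⟩ := exists_primitive_coangle_gt
  have hlow : ∀ᶠ x in 𝓝[>] (0 : ℝ), primitive (coangle x) < 1 / (2 * π ^ 2) :=
    tendsto_primitive_coangle_zero.eventually (gt_mem_nhds (by positivity))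
  obtain ⟨x₂, h₂, hx₂⟩ := (hlow.and self_mem_nhdsWithin).exists
  have hx₂' : 0 < x₂ := hx₂
  have hcont : ContinuousOn (fun x => primitive (coangle x)) (Ioi 0) :=
    fun x hx => (hasDerivAt_primitive_coangle hx).continuousAt.continuousWithinAt
  obtain ⟨x, hx, e⟩ := isPreconnected_Ioi.intermediate_value hx₂' hx₁ hcont ⟨h₂.le, h₁.le⟩
  exact ⟨x, hx, (zeta_eq_zero_iff hx).2 e⟩

end BesselZeta

theorem mainTheorem5 :
    (∀ x : ℝ, 0 < x → IntervalIntegrable BesselZeta.Theta0 volume 0 x) ∧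
    ContinuousOn BesselZeta.zeta (Ioi 0) ∧
    Tendsto BesselZeta.zeta (𝓝[>] 0) (𝓝 (1 / (8 * Real.pi))) ∧
    Tendsto BesselZeta.zeta atTop atBot ∧
    ∃! x₀ : ℝ, 0 < x₀ ∧ ∀ x : ℝ, 0 < x → (BesselZeta.zeta x = 0 ↔ x = x₀) := by
  obtain ⟨x₀, hx₀, h₀⟩ := BesselZeta.exists_zeta_eq_zero
  refine ⟨fun x hx => (BesselZeta.integral_Theta0 hx).1, BesselZeta.continuousOn_zeta,
    BesselZeta.tendsto_zeta_zero, BesselZeta.tendsto_zeta_atTop, x₀, ⟨hx₀, fun x hx => ?_⟩, ?_⟩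
  · refine ⟨fun h => ?_, fun h => h ▸ h₀⟩
    refine BesselZeta.strictMonoOn_primitive_coangle.injOn hx hx₀ ?_
    exact ((BesselZeta.zeta_eq_zero_iff hx).1 h).trans
      ((BesselZeta.zeta_eq_zero_iff hx₀).1 h₀).symm
  · rintro y ⟨hy, h⟩
    exact ((h x₀ hx₀).1 h₀).symm
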